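/- Let $G$ be an abelian group (written additively) with $|G|\le 2^{\mathfrak c}$, where $\mathfrak c=|\mathbb R|$, and let $\mathscr X$ be a countable family of subsets of $G$. For $n\in\mathbb N=\{0,1,2,\dots\}$ put $G[n]=\{x\in G: nx=0\}$. The Zariski topology $\mathfrak Z_G$ of $G$ is the topology whose closed sets are exactly the arbitrary intersections of finite unions of sets of the form $g+G[n]$ with $g\in G$ and $n\in\mathbb N$, and the Zariski closure of $X\subseteq G$ (Markov's algebraic closure) is the $\mathfrak Z_G$-closure of $X$. A topological group is called precompact if its completion is compact. Then there exists a precompact Hausdorff group topology $\mathcal T$ on $G$ such that for every $X\in\mathscr X$ the $\mathcal T$-closure of $X$ coincides with the Zariski closure of $X$ in $G$. -/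

import Mathlib

open Set Topology Cardinal

namespace AbelianZariski

section Zariski

variable {G : Type*} [AddCommGroup G]

/-- Elementary algebraic subsets of an abelian group `G`: the cosets `g + G[n]`, where `g ∈ G`,
`n ∈ ℕ` (with `n = 0` allowed) and `G[n] = {x | n x = 0}`. -/
def IsElementaryAlgebraic (S : Set G) : Prop :=
  ∃ (g : G) (n : ℕ), S = (fun x => g + x) '' {x : G | n • x = 0}

/-- Finite (possibly empty) unions of elementary algebraic sets. -/
def IsFiniteUnionOfElementary (S : Set G) : Prop :=
  ∃ F : Set (Set G), F.Finite ∧ (∀ A ∈ F, IsElementaryAlgebraic A) ∧ S = ⋃₀ F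

/-- Algebraic subsets: arbitrary intersections of finite unions of elementary algebraic sets. -/
def IsAlgebraicSubset (S : Set G) : Prop :=
  ∃ 𝒜 : Set (Set G), (∀ A ∈ 𝒜, IsFiniteUnionOfElementary A) ∧ S = ⋂₀ 𝒜

theorem IsFiniteUnionOfElementary.union {A B : Set G} (hA : IsFiniteUnionOfElementary A)
    (hB : IsFiniteUnionOfElementary B) : IsFiniteUnionOfElementary (A ∪ B) := by
  obtain ⟨F, hF, hF', rfl⟩ := hA
  obtain ⟨H, hH, hH', rfl⟩ := hB
  refine ⟨F ∪ H, hF.union hH, ?_, (sUnion_union F H).symm⟩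
  rintro C (hC | hC)
  · exact hF' C hC
  · exact hH' C hC

theorem IsAlgebraicSubset.empty : IsAlgebraicSubset (∅ : Set G) :=
  ⟨{∅}, by rintro A rfl; exact ⟨∅, finite_empty, by simp, by simp⟩, by simp⟩

theorem IsAlgebraicSubset.sInter {𝒮 : Set (Set G)} (h : ∀ S ∈ 𝒮, IsAlgebraicSubset S) :
    IsAlgebraicSubset (⋂₀ 𝒮) := by
  refine ⟨{A | IsFiniteUnionOfElementary A ∧ ⋂₀ 𝒮 ⊆ A}, fun A hA => hA.1, ?_⟩
  apply Subset.antisymm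
  · exact subset_sInter fun A hA => hA.2
  · refine subset_sInter fun S hS => ?_
    obtain ⟨𝒜, h𝒜, rfl⟩ := h S hS
    refine subset_sInter fun A hA => sInter_subset_of_mem ⟨h𝒜 A hA, ?_⟩
    exact (sInter_subset_of_mem hS).trans (sInter_subset_of_mem hA)

theorem IsAlgebraicSubset.union {S T : Set G} (hS : IsAlgebraicSubset S)
    (hT : IsAlgebraicSubset T) : IsAlgebraicSubset (S ∪ T) := by
  obtain ⟨𝒜, h𝒜, rfl⟩ := hS
  obtain ⟨ℬ, hℬ, rfl⟩ := hT
  refine ⟨{C | ∃ A ∈ 𝒜, ∃ B ∈ ℬ, C = A ∪ B}, ?_, ?_⟩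
  · rintro C ⟨A, hA, B, hB, rfl⟩
    exact (h𝒜 A hA).union (hℬ B hB)
  · apply Subset.antisymm
    · rintro x hx C ⟨A, hA, B, hB, rfl⟩
      exact hx.imp (fun h => h A hA) (fun h => h B hB)
    · intro x hx
      by_contra hne
      simp only [mem_union, mem_sInter, not_or, not_forall] at hne
      obtain ⟨⟨A, hA, hxA⟩, B, hB, hxB⟩ := hne
      exact (hx _ ⟨A, hA, B, hB, rfl⟩).elim hxA hxB

variable (G) in
/-- The Zariski topology of an abelian group: its closed sets are exactly the algebraic sets. -/
abbrev zariskiTopology : TopologicalSpace G :=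
  TopologicalSpace.ofClosed {S : Set G | IsAlgebraicSubset S} IsAlgebraicSubset.empty
    (fun _ h => IsAlgebraicSubset.sInter h) (fun _ hS _ hT => hS.union hT)

theorem isClosed_zariskiTopology_iff {S : Set G} :
    IsClosed[zariskiTopology G] S ↔ IsAlgebraicSubset S := by
  rw [← @isOpen_compl_iff _ _ (zariskiTopology G)]
  change IsAlgebraicSubset Sᶜᶜ ↔ _
  rw [compl_compl]

end Zariski

/-- A topological abelian group is precompact if its completion (with respect to the
group uniformity) is compact. -/
def IsPrecompact (G : Type*) [AddCommGroup G] [TopologicalSpace G] [IsTopologicalAddGroup G] :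
    Prop :=
  letI : UniformSpace G := IsTopologicalAddGroup.rightUniformSpace G
  CompactSpace (UniformSpace.Completion G)

end AbelianZariski

/-! Embed `G` in a torus by a family of characters `h j`, indexed by `J = ℕ × (ℕ → Bool)`. The
induced topology is precompact, and Hausdorff when the family separates points. Zariski closed sets
are closed in every Hausdorff group topology, so only one inclusion between the closures is at
stake.

Each `X` lies in a finite union of cosets `g + G[n]` such that the part of `X - g` in `G[n]` is
thick (`exists_finite_thick_cover`). This union is Zariski closed, so it suffices that `X` be dense
in it. That follows if finitely many `h j` can bring some `s` in a thick subset of `G[n]`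
arbitrarily close to any tuple of `n`-torsion points.

Thickness is witnessed by countable sets, so density only concerns a countable subgroup `H`. There
Baire category, applied to characters depending continuously on a Cantor parameter, gives continuum
many generic characters (`exists_generic_characters`). One parameter `α₀` already separates the
points of `H`, so the common kernel `N` of the extensions of its characters to `G` meets `H`
trivially. The remaining continuum many characters can thus be prescribed on `N` to separate its
points, which `#G ≤ 2 ^ 𝔠` permits (`exists_separating_characters`). -/

namespace AbelianZariski

/-! ### Homomorphisms into divisible groups -/

section Extension

/-- A homomorphism into a divisible group factors through any homomorphism with smaller kernel. -/
theorem exists_comp_eq {M H Q : Type*} [AddCommGroup M] [AddCommGroup H] [AddCommGroup Q]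
    [DivisibleBy Q ℤ] (φ : M →+ H) (ψ : M →+ Q) (h : ∀ m, φ m = 0 → ψ m = 0) :
    ∃ χ : H →+ Q, ∀ m, χ (φ m) = ψ m := by
  let g : M ⧸ φ.ker →+ Q := QuotientAddGroup.lift φ.ker ψ fun m hm => h m hm
  obtain ⟨χ, hχ⟩ := (Module.Baer.of_divisible Q).extension_property_addMonoidHom
    (QuotientAddGroup.kerLift φ) (QuotientAddGroup.kerLift_injective φ) g
  refine ⟨χ, fun m => ?_⟩
  exact DFunLike.congr_fun hχ (m : M ⧸ φ.ker)

theorem exists_extend {H Q : Type*} [AddCommGroup H] [AddCommGroup Q]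
    [DivisibleBy Q ℤ] (A : AddSubgroup H) (ψ : A →+ Q) :
    ∃ χ : H →+ Q, ∀ a : A, χ a = ψ a :=
  exists_comp_eq A.subtype ψ fun a ha => by
    rw [show a = 0 from Subtype.ext (by simpa using ha), map_zero]

/-- A value of a homomorphism vanishing on a subgroup may be prescribed at a further element. -/
theorem exists_eq_zero_and_eq {H Q : Type*} [AddCommGroup H] [AddCommGroup Q]
    [DivisibleBy Q ℤ] (A : AddSubgroup H) (s : H) (u : Q) (h : ∀ k : ℤ, k • s ∈ A → k • u = 0) :
    ∃ χ : H →+ Q, (∀ a ∈ A, χ a = 0) ∧ χ s = u := by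
  obtain ⟨χ, hχ⟩ := exists_comp_eq (zmultiplesHom (H ⧸ A) (s : H ⧸ A)) (zmultiplesHom Q u)
    fun k hk => h k <| by
      rw [← QuotientAddGroup.eq_zero_iff]
      simpa using hk
  refine ⟨χ.comp (QuotientAddGroup.mk' A), fun a ha => ?_, by simpa using hχ 1⟩
  simp [(QuotientAddGroup.eq_zero_iff a).2 ha]

end Extension

/-! ### Thick sets and coset covers -/

section Thick

variable {G : Type*} [AddCommGroup G]

/-- `S` is thick in `G[n]` if it is contained in `G[n]` but not in the union of finitely many
cosets of subgroups `G[d]` with `d` a proper divisor of `n`. -/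
def Thick (S : Set G) (n : ℕ) : Prop :=
  (∀ s ∈ S, n • s = 0) ∧ ∀ P : Set (G × ℕ), P.Finite → (∀ p ∈ P, p.2 ∣ n ∧ p.2 ≠ n) →
    ∃ s ∈ S, ∀ p ∈ P, p.2 • s ≠ p.2 • p.1

/-- Choose points of `S` with increasing bounds, each new point avoiding the cosets of earlier
points modulo `G[d]` for all proper divisors `d` up to its bound. The bounds are needed for `n = 0`,
where every positive `d` is a proper divisor. By pigeonhole, finitely many cosets cannot cover the
sequence. -/
theorem Thick.exists_countable {S : Set G} {n : ℕ} (h : Thick S n) :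
    ∃ S' ⊆ S, S'.Countable ∧ Thick S' n := by
  classical
  obtain ⟨f, hf, hr⟩ := exists_seq_of_forall_finset_exists (fun x : G × ℕ => x.1 ∈ S)
    (fun x y => x.2 < y.2 ∧ ∀ d ≤ y.2, d ∣ n → d ≠ n → d • x.1 ≠ d • y.1) (fun s _ => by
      let l := s.sup (fun x => x.2) + 1
      let P : Set (G × ℕ) := {p | (p.2 ∣ n ∧ p.2 ≠ n) ∧
        p ∈ (s.image fun x => x.1) ×ˢ Finset.range (l + 1)}
      obtain ⟨y, hy, hyP⟩ := h.2 P ((Finset.finite_toSet _).subset fun p hp => hp.2)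
        fun p hp => hp.1
      refine ⟨(y, l), hy, fun x hx => ⟨Nat.lt_succ_of_le (Finset.le_sup (f := fun x => x.2) hx),
        fun d hd hdn hdn' he => hyP (x.1, d) ⟨⟨hdn, hdn'⟩, ?_⟩ he.symm⟩⟩
      simp only [Finset.mem_product, Finset.mem_image, Finset.mem_range]
      exact ⟨⟨x, hx, rfl⟩, Nat.lt_succ_of_le hd⟩)
  have hmono : StrictMono fun k => (f k).2 := fun a b hab => (hr a b hab).1
  refine ⟨range fun k => (f k).1, ?_, countable_range _, ?_, ?_⟩
  · rintro _ ⟨k, rfl⟩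
    exact hf k
  · rintro _ ⟨k, rfl⟩
    exact h.1 _ (hf k)
  · intro P hP hPn
    by_contra! hcon
    obtain ⟨L, hL⟩ : ∃ L, ∀ p ∈ P, p.2 ≤ L := by
      obtain ⟨L, hL⟩ := (hP.image Prod.snd).bddAbove
      exact ⟨L, fun p hp => hL ⟨p, hp, rfl⟩⟩
    have hk : ∀ k, ∃ p : P, p.1.2 • (f (L + k)).1 = p.1.2 • p.1.1 := fun k => by
      obtain ⟨p, hp, he⟩ := hcon _ ⟨L + k, rfl⟩
      exact ⟨⟨p, hp⟩, he⟩
    choose p hp using hk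
    have := hP.to_subtype
    obtain ⟨a, b, hab, he⟩ := Finite.exists_ne_map_eq_of_infinite p
    wlog hlt : a < b generalizing a b
    · exact this b a hab.symm he.symm (lt_of_le_of_ne (not_lt.1 hlt) hab.symm)
    have h1 := hp a
    rw [he, ← hp b] at h1
    refine (hr (L + a) (L + b) (by omega)).2 _ ?_ (hPn _ (p b).2).1 (hPn _ (p b).2).2 h1
    exact (hL _ (p b).2).trans ((Nat.le_add_right L b).trans (hmono.id_le _))

/-- Every set is covered by finitely many cosets `g + G[n]` in which it is thick. -/
theorem exists_finite_thick_cover (X : Set G) :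
    ∃ P : Set (G × ℕ), P.Finite ∧ (∀ x ∈ X, ∃ p ∈ P, p.2 • (x - p.1) = 0) ∧
      ∀ p ∈ P, Thick {s | p.1 + s ∈ X ∧ p.2 • s = 0} p.2 := by
  suffices H : ∀ (n : ℕ) (g : G), ∃ P : Set (G × ℕ), P.Finite ∧
      (∀ x ∈ X, n • (x - g) = 0 → ∃ p ∈ P, p.2 • (x - p.1) = 0) ∧
      ∀ p ∈ P, Thick {s | p.1 + s ∈ X ∧ p.2 • s = 0} p.2 by
    obtain ⟨P, hP, hPX, hPT⟩ := H 0 0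
    exact ⟨P, hP, fun x hx => hPX x hx (by simp), hPT⟩
  intro n
  -- Strict divisibility is well founded with `0` on top. Where thickness fails, the coset is
  -- replaced by the finitely many smaller ones witnessing the failure.
  induction n using (wellFounded_dvdNotUnit (α := ℕ)).induction with
  | _ n ih =>
  intro g
  by_cases hT : Thick {s | g + s ∈ X ∧ n • s = 0} n
  · exact ⟨{(g, n)}, finite_singleton _, fun x _ hn => ⟨(g, n), rfl, hn⟩, by rintro _ rfl; exact hT⟩
  · simp only [Thick, not_and, not_forall] at hT
    obtain ⟨Q, hQ, hQn, hcov⟩ := hT fun s hs => hs.2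
    push Not at hcov
    have key : ∀ q : Q, ∃ P : Set (G × ℕ), P.Finite ∧
        (∀ x ∈ X, q.1.2 • (x - (g + q.1.1)) = 0 → ∃ p ∈ P, p.2 • (x - p.1) = 0) ∧
        ∀ p ∈ P, Thick {s | p.1 + s ∈ X ∧ p.2 • s = 0} p.2 := fun q => by
      refine ih q.1.2 ?_ _
      obtain ⟨h1, h2⟩ := hQn q.1 q.2
      refine dvdNotUnit_of_dvd_of_not_dvd h1 fun h3 => h2 (Nat.dvd_antisymm h1 h3)
    choose P hP hPX hPT using key
    have := hQ.to_subtype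
    refine ⟨⋃ q, P q, finite_iUnion hP, fun x hx hn => ?_, fun p hp => ?_⟩
    · obtain ⟨q, hq, he⟩ := hcov (x - g) ⟨by simpa using hx, hn⟩
      obtain ⟨p, hp, hp'⟩ := hPX ⟨q, hq⟩ x hx (by
        rw [← sub_sub, smul_sub, he, sub_self])
      exact ⟨p, mem_iUnion.2 ⟨_, hp⟩, hp'⟩
    · obtain ⟨q, hq⟩ := mem_iUnion.1 hp
      exact hPT q p hq

theorem Thick.preimage {H : AddSubgroup G} {S : Set G} {n : ℕ} (h : Thick S n) (hS : S ⊆ H) :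
    Thick (((↑) : H → G) ⁻¹' S) n := by
  refine ⟨fun s hs => Subtype.ext (by simpa using h.1 _ hs), fun P hP hPn => ?_⟩
  obtain ⟨s, hs, hsP⟩ := h.2 (Prod.map (↑) id '' P) (hP.image _) (by
    rintro _ ⟨p, hp, rfl⟩
    exact hPn p hp)
  refine ⟨⟨s, hS hs⟩, hs, fun p hp he => hsP _ ⟨p, hp, rfl⟩ ?_⟩
  simpa using congrArg ((↑) : H → G) he

end Thick

/-! ### Finitely generated abelian groups -/

section FinitelyGenerated

theorem exists_finite_torsion_free_coordinates (A : Type*) [AddCommGroup A] [AddGroup.FG A] :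
    ∃ (r : ℕ) (c : A →+ (Fin r →₀ ℤ)), (c.ker : Set A).Finite := by
  obtain ⟨r, ι, _, p, hp, e, ⟨E⟩⟩ := AddCommGroup.equiv_free_prod_directSum_zmod A
  classical
  have : ∀ i, NeZero (p i ^ e i) := fun i => ⟨pow_ne_zero _ (hp i).ne_zero⟩
  have hB : Finite (DirectSum ι fun i => ZMod (p i ^ e i)) :=
    Finite.of_equiv _ (DirectSum.addEquivProd fun i => ZMod (p i ^ e i)).symm.toEquiv
  refine ⟨r, (AddMonoidHom.fst _ _).comp E.toAddMonoidHom, ?_⟩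
  refine Set.Finite.of_finite_image (f := fun a => (E a).2) (toFinite _) fun a ha b hb he => ?_
  exact E.injective (Prod.ext ((show (E a).1 = 0 from ha).trans (show (E b).1 = 0 from hb).symm) he)

theorem finite_nsmul_eq_zero (A : Type*) [AddCommGroup A] [AddGroup.FG A] {n : ℕ} (hn : n ≠ 0) :
    {a : A | n • a = 0}.Finite := by
  obtain ⟨r, c, hc⟩ := exists_finite_torsion_free_coordinates A
  refine hc.subset fun a ha => ?_
  have h : n • c a = 0 := by rw [← map_nsmul, show n • a = 0 from ha, map_zero]
  exact (smul_eq_zero.1 h).resolve_left hn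

/-- An infinite subset of a finitely generated abelian group is unbounded under some real
character. -/
theorem exists_real_hom_unbounded {A : Type*} [AddCommGroup A] [AddGroup.FG A] {Y : Set A}
    (hY : Y.Infinite) : ∃ l : A →+ ℝ, ∀ C : ℝ, ∃ y ∈ Y, C < |l y| := by
  obtain ⟨r, c, hc⟩ := exists_finite_torsion_free_coordinates A
  by_contra! hcon
  let l : Fin r → A →+ ℝ := fun i =>
    (Int.castAddHom ℝ).comp ((Finsupp.applyAddHom i).comp c)
  choose C hC using fun i => hcon (l i)
  refine hY ?_
  have himg : (c '' Y).Finite := by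
    have hfin : (Set.univ.pi fun i : Fin r => Set.Icc (-⌈C i⌉) ⌈C i⌉).Finite :=
      Set.Finite.pi fun i => Set.finite_Icc _ _
    refine Set.Finite.of_finite_image (f := fun v => (v : Fin r → ℤ)) (hfin.subset ?_)
      DFunLike.coe_injective.injOn
    rintro _ ⟨_, ⟨y, hy, rfl⟩, rfl⟩ i -
    have h := abs_le.1 (hC i y hy)
    have h1 : ((c y i : ℤ) : ℝ) ≤ ⌈C i⌉ := h.2.trans (Int.le_ceil _)
    have h2 : ((-⌈C i⌉ : ℤ) : ℝ) ≤ c y i := by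
      push_cast
      exact (neg_le_neg (Int.le_ceil _)).trans h.1
    exact ⟨by exact_mod_cast h2, by exact_mod_cast h1⟩
  refine Set.Finite.of_finite_fibers c himg fun v _ => ?_
  rcases (Y ∩ c ⁻¹' {v}).eq_empty_or_nonempty with h | ⟨a, -, ha⟩
  · rw [h]; exact finite_empty
  · refine (hc.image (fun k => a + k)).subset fun b hb => ⟨b - a, ?_, by simp⟩
    have h1 : c a = v := ha
    have h2 : c b = v := hb.2
    simp [h1, h2]

end FinitelyGenerated

/-! ### Characters with nearly prescribed values on thick sets -/

section Approximation

theorem exists_norm_sub_lt_of_nsmul {d : ℕ} {ε : ℝ} (hd : 0 < d) (hε : 1 / (d : ℝ) < ε)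
    (t : UnitAddCircle) : ∃ u : UnitAddCircle, d • u = 0 ∧ ‖u - t‖ < ε := by
  induction t using QuotientAddGroup.induction_on with
  | H x =>
  have hd' : (0 : ℝ) < d := by exact_mod_cast hd
  refine ⟨((round (x * d) / d : ℝ) : UnitAddCircle), ?_, ?_⟩
  · rw [← AddCircle.coe_nsmul, AddCircle.coe_eq_zero_iff]
    exact ⟨round (x * d), by simp; field_simp⟩
  · rw [← AddCircle.coe_sub]
    refine lt_of_le_of_lt (QuotientAddGroup.norm_mk_le_norm) (lt_of_le_of_lt ?_ hε)
    rw [Real.norm_eq_abs, show (round (x * d) / d - x : ℝ) = (round (x * d) - x * d) / d by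
      field_simp, abs_div, abs_of_pos hd', abs_sub_comm]
    gcongr
    exact (abs_sub_round _).trans (by norm_num)

variable {H : Type*} [AddCommGroup H]

/-- The `n`-torsion of `A` is finite, so thickness yields an `s` with `d • s ∉ A` for every proper
divisor `d` of `n`. Its order modulo `A` is then exactly `n`. -/
theorem Thick.exists_forall_character_of_pos {S : Set H} {n : ℕ} (hS : Thick S n) (hn : n ≠ 0)
    (A : AddSubgroup H) [AddGroup.FG A] :
    ∃ s ∈ S, ∀ t : UnitAddCircle, n • t = 0 →
      ∃ χ : H →+ UnitAddCircle, (∀ x ∈ A, χ x = 0) ∧ χ s = t := by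
  have hfin := finite_nsmul_eq_zero A hn
  -- `rep (a, d)` solves `d • x = a` when possible, so all solutions form one coset of the
  -- `d`-torsion.
  obtain ⟨rep, hrep⟩ : ∃ rep : A × ℕ → H, ∀ p, ∀ s, p.2 • s = (p.1 : H) →
      p.2 • rep p = (p.1 : H) := by
    classical
    refine ⟨fun p => if h : ∃ s : H, p.2 • s = (p.1 : H) then h.choose else 0, fun p s hs => ?_⟩
    have h : ∃ s : H, p.2 • s = (p.1 : H) := ⟨s, hs⟩
    simp only [dif_pos h]
    exact h.choose_spec
  obtain ⟨s, hs, hsP⟩ := hS.2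
    ((fun p : A × ℕ => (rep p, p.2)) ''
      ({a : A | n • a = 0} ×ˢ {d : ℕ | d ∣ n ∧ d ≠ n}))
    ((hfin.prod ((Set.finite_Iic n).subset fun d hd =>
      Nat.le_of_dvd (Nat.pos_of_ne_zero hn) hd.1)).image _) (by
      rintro _ ⟨p, hp, rfl⟩
      exact hp.2)
  have hns := hS.1 s hs
  refine ⟨s, hs, fun t ht => exists_eq_zero_and_eq A s t fun k hk => ?_⟩
  have hd : Int.gcd k n ∣ n := by exact_mod_cast Int.gcd_dvd_right k (n : ℤ)
  have hmem : Int.gcd k n • s ∈ A := by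
    rw [← natCast_zsmul, Int.gcd_eq_gcd_ab, add_zsmul, mul_comm k, mul_comm (n : ℤ), mul_zsmul,
      mul_zsmul, natCast_zsmul, hns, zsmul_zero, add_zero]
    exact A.zsmul_mem hk _
  have hdn : Int.gcd k n = n := by
    by_contra hne
    refine hsP _ ⟨(⟨_, hmem⟩, Int.gcd k n), ⟨Subtype.ext ?_, hd, hne⟩, rfl⟩ ?_
    · simp [smul_comm n, hns]
    · exact (hrep (⟨_, hmem⟩, Int.gcd k n) s rfl).symm
  obtain ⟨m, rfl⟩ : (n : ℤ) ∣ k := by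
    rw [← hdn]
    exact Int.gcd_dvd_left k (n : ℤ)
  rw [mul_comm, mul_zsmul, natCast_zsmul, ht, zsmul_zero]

/-- If some `s ∈ S` has large or infinite order modulo the group `A` generated by `F`, then `χ` can
vanish on `A` with `χ s` near `t`. Otherwise a fixed nonzero multiple carries `S` onto an infinite
subset of `A`, and a real homomorphism huge at some `s` compared with `F` is rescaled and reduced
modulo 1. -/
theorem Thick.exists_forall_character_of_zero {S : Set H} (hS : Thick S 0)
    {F : Set H} (hF : F.Finite) {ε : ℝ} (hε : 0 < ε) :
    ∃ s ∈ S, ∀ t : UnitAddCircle,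
      ∃ χ : H →+ UnitAddCircle, (∀ x ∈ F, ‖χ x‖ < ε) ∧ ‖χ s - t‖ < ε := by
  let A := AddSubgroup.closure F
  have : AddGroup.FG A := (AddGroup.fg_iff_addSubgroup_fg A).2 ⟨hF.toFinset, by simp [A]⟩
  have hFA : F ⊆ A := AddSubgroup.subset_closure
  obtain ⟨D, hD⟩ := exists_nat_one_div_lt hε
  by_cases hc : ∃ s ∈ S, ∀ d ∈ Finset.Icc 1 (D + 1), d • s ∉ A
  · obtain ⟨s, hs, hsA⟩ := hc
    refine ⟨s, hs, fun t => ?_⟩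
    have hu : ∃ u, (∀ k : ℤ, k • s ∈ A → k • u = 0) ∧ ‖u - t‖ < ε := by
      have hmem : ∀ k : ℤ, k • s ∈ A ↔ k • (s : H ⧸ A) = 0 := fun k => by
        rw [← QuotientAddGroup.eq_zero_iff, QuotientAddGroup.mk_zsmul]
      rcases Nat.eq_zero_or_pos (addOrderOf (s : H ⧸ A)) with h0 | hpos
      · refine ⟨t, fun k hk => ?_, by simpa⟩
        rw [hmem, ← addOrderOf_dvd_iff_zsmul_eq_zero, h0] at hk
        simp [Int.zero_dvd.1 (by simpa using hk)]
      · have hlt : D + 1 < addOrderOf (s : H ⧸ A) := by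
          by_contra! hle
          refine hsA _ (Finset.mem_Icc.2 ⟨hpos, hle⟩) ?_
          have := (hmem (addOrderOf (s : H ⧸ A))).2 (by simp)
          simpa using this
        obtain ⟨u, hu, hut⟩ := exists_norm_sub_lt_of_nsmul hpos (ε := ε) (by
          refine lt_trans ?_ hD
          have : ((D : ℝ) + 1) < addOrderOf (s : H ⧸ A) := by exact_mod_cast hlt
          exact one_div_lt_one_div_of_lt (by positivity) this) t
        refine ⟨u, fun k hk => ?_, hut⟩
        rw [hmem, ← addOrderOf_dvd_iff_zsmul_eq_zero] at hk
        obtain ⟨m, rfl⟩ := hk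
        rw [mul_comm, mul_zsmul, natCast_zsmul, hu, zsmul_zero]
    obtain ⟨u, hu, hut⟩ := hu
    obtain ⟨χ, hχ, rfl⟩ := exists_eq_zero_and_eq A s u hu
    exact ⟨χ, fun x hx => by rw [hχ x (hFA hx)]; simpa, hut⟩
  · push Not at hc
    let e := (D + 1).factorial
    have he : e ≠ 0 := (D + 1).factorial_ne_zero
    have heA : ∀ s ∈ S, e • s ∈ A := fun s hs => by
      obtain ⟨d, hd, hds⟩ := hc s hs
      rw [Finset.mem_Icc] at hd
      obtain ⟨m, hm⟩ := Nat.dvd_factorial hd.1 hd.2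
      rw [show e = d * m from hm, mul_comm, mul_nsmul']
      exact A.nsmul_mem hds _
    let Y : Set A := {a | ∃ s ∈ S, e • s = (a : H)}
    have hY : Y.Infinite := fun hYf => by
      have hch : ∀ a : Y, ∃ s ∈ S, e • s = (a.1 : H) := fun a => a.2
      choose g hg hga using hch
      have := hYf.to_subtype
      obtain ⟨s, hs, hsP⟩ := hS.2 (range fun a : Y => (g a, e)) (finite_range _) (by
        rintro _ ⟨a, rfl⟩
        exact ⟨dvd_zero _, he⟩)
      exact hsP _ ⟨⟨⟨_, heA s hs⟩, s, hs, rfl⟩, rfl⟩ (hga ⟨⟨_, heA s hs⟩, s, hs, rfl⟩).symm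
    obtain ⟨l₀, hl₀⟩ := exists_real_hom_unbounded hY
    obtain ⟨l, hl⟩ := exists_extend A l₀
    obtain ⟨M, hM⟩ : ∃ M, ∀ x ∈ F, |l x| ≤ M := by
      obtain ⟨M, hM⟩ := (hF.image fun x => |l x|).bddAbove
      exact ⟨M, fun x hx => hM ⟨x, hx, rfl⟩⟩
    -- Since `a = e • s`, this makes `|l s|` exceed `(|M| + 1) / ε`, so scaling `l` by `x / l s`
    -- with `|x| ≤ 1` keeps it below `ε` on `F`.
    obtain ⟨a, ⟨s, hs, hsa⟩, has⟩ := hl₀ (e * ((|M| + 1) / ε))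
    have hls : (|M| + 1) / ε < |l s| := by
      rw [← hl, ← hsa, map_nsmul, nsmul_eq_mul, abs_mul, Nat.abs_cast] at has
      exact lt_of_mul_lt_mul_left has (Nat.cast_nonneg _)
    have hpos : 0 < |l s| := lt_of_le_of_lt (by positivity) hls
    refine ⟨s, hs, fun t => ?_⟩
    obtain ⟨x, hx, rfl⟩ : ∃ x : ℝ, |x| ≤ 1 ∧ (x : UnitAddCircle) = t := by
      induction t using QuotientAddGroup.induction_on with
      | H y =>
      refine ⟨Int.fract y, ?_, ?_⟩
      · rw [abs_of_nonneg (Int.fract_nonneg y)]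
        exact (Int.fract_lt_one y).le
      · exact QuotientAddGroup.eq_iff_sub_mem.2 ⟨-⌊y⌋, by simp [← Int.self_sub_floor]⟩
    let χ : H →+ UnitAddCircle :=
      (QuotientAddGroup.mk' (AddSubgroup.zmultiples (1 : ℝ))).comp
        ((AddMonoidHom.mulLeft (x / l s)).comp l)
    have hχ : ∀ y, χ y = ((x / l s * l y : ℝ) : UnitAddCircle) := fun y => rfl
    refine ⟨χ, fun y hy => ?_, ?_⟩
    · rw [hχ]
      refine lt_of_le_of_lt QuotientAddGroup.norm_mk_le_norm ?_
      rw [Real.norm_eq_abs, abs_mul, abs_div, div_mul_eq_mul_div, div_lt_iff₀ hpos]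
      rw [div_lt_iff₀ hε] at hls
      have h1 : |l y| ≤ |M| := (hM y hy).trans (le_abs_self M)
      calc |x| * |l y| ≤ 1 * |M| := mul_le_mul hx h1 (abs_nonneg _) zero_le_one
        _ < ε * |l s| := by linarith
    · rw [hχ, div_mul_cancel₀ _ (abs_pos.1 hpos), sub_self, norm_zero]
      exact hε

/-- Characters that are small on a finite set take almost arbitrary values on some element of a
thick set. -/
theorem Thick.exists_forall_character {S : Set H} {n : ℕ} (hS : Thick S n)
    {F : Set H} (hF : F.Finite) {ε : ℝ} (hε : 0 < ε) :
    ∃ s ∈ S, ∀ t : UnitAddCircle, n • t = 0 →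
      ∃ χ : H →+ UnitAddCircle, (∀ x ∈ F, ‖χ x‖ < ε) ∧ ‖χ s - t‖ < ε := by
  rcases eq_or_ne n 0 with rfl | hn
  · obtain ⟨s, hs, h⟩ := hS.exists_forall_character_of_zero hF hε
    exact ⟨s, hs, fun t _ => h t⟩
  · have : AddGroup.FG (AddSubgroup.closure F) :=
      (AddGroup.fg_iff_addSubgroup_fg _).2 ⟨hF.toFinset, by simp⟩
    obtain ⟨s, hs, h⟩ := hS.exists_forall_character_of_pos hn (AddSubgroup.closure F)
    refine ⟨s, hs, fun t ht => ?_⟩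
    obtain ⟨χ, hχ, rfl⟩ := h t ht
    exact ⟨χ, fun x hx => by rw [hχ x (AddSubgroup.subset_closure hx)]; simpa, by simpa⟩

end Approximation

/-! ### Uniform approximation on the Cantor space -/

section Cantor

/-- The first `k` digits of a point of the Cantor space. -/
def initialDigits (k : ℕ) (α : ℕ → Bool) : Fin k → Bool := fun i => α i

/-- The extension of a finite sequence of digits by `false`. -/
def padDigits {k : ℕ} (σ : Fin k → Bool) : ℕ → Bool :=
  fun i => if h : i < k then σ ⟨i, h⟩ else false

theorem continuous_initialDigits (k : ℕ) : Continuous (initialDigits k) := by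
  unfold initialDigits
  fun_prop

theorem initialDigits_padDigits {k : ℕ} (σ : Fin k → Bool) : initialDigits k (padDigits σ) = σ := by
  ext i
  simp [initialDigits, padDigits]

theorem initialDigits_eq_of_le {k l : ℕ} (h : k ≤ l) {α β : ℕ → Bool}
    (he : initialDigits l α = initialDigits l β) : initialDigits k α = initialDigits k β := by
  ext i
  exact congrFun he ⟨i, i.2.trans_le h⟩

theorem exists_initialDigits_subset {α : ℕ → Bool} {U : Set (ℕ → Bool)} (hU : U ∈ 𝓝 α) :
    ∃ k, ∀ β, initialDigits k β = initialDigits k α → β ∈ U := by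
  obtain ⟨V, hVU, hV, hα⟩ := mem_nhds_iff.1 hU
  obtain ⟨I, u, hu, hI⟩ := isOpen_pi_iff.1 hV α hα
  refine ⟨I.sup id + 1, fun β hβ => hVU (hI fun i hi => ?_)⟩
  have : β i = α i := congrFun hβ ⟨i, Nat.lt_succ_of_le (Finset.le_sup (f := id) hi)⟩
  rw [this]
  exact (hu i hi).2

theorem eventually_dist_padDigits_lt {E : Type*} [PseudoMetricSpace E] (g : C(ℕ → Bool, E)) {ε : ℝ}
    (hε : 0 < ε) :
    ∃ k₀, ∀ k ≥ k₀, ∀ α, dist (g (padDigits (initialDigits k α))) (g α) < ε := by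
  have hloc : ∀ α, ∃ k, ∀ β, initialDigits k β = initialDigits k α → dist (g β) (g α) < ε / 2 :=
    fun α => exists_initialDigits_subset
      (g.continuous.continuousAt.preimage_mem_nhds (Metric.ball_mem_nhds _ (half_pos hε)))
  choose k hk using hloc
  obtain ⟨t, ht⟩ := CompactSpace.elim_nhds_subcover
    (fun α => initialDigits (k α) ⁻¹' {initialDigits (k α) α}) fun α =>
      (continuous_initialDigits _).continuousAt.preimage_mem_nhds
        ((isOpen_discrete _).mem_nhds rfl)
  refine ⟨t.sup k, fun l hl α => ?_⟩
  have hα : α ∈ (⊤ : Set (ℕ → Bool)) := trivial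
  rw [← ht] at hα
  simp only [mem_iUnion] at hα
  obtain ⟨β, hβ, hαβ⟩ := hα
  have hαβ : initialDigits (k β) α = initialDigits (k β) β := hαβ
  have h1 : initialDigits (k β) (padDigits (initialDigits l α)) = initialDigits (k β) α :=
    initialDigits_eq_of_le ((Finset.le_sup hβ).trans hl) (initialDigits_padDigits _)
  have h2 := hk β α hαβ
  have h3 := hk β _ (h1.trans hαβ)
  have h4 := dist_triangle_right (g (padDigits (initialDigits l α))) (g α) (g β)
  linarith

end Cantor

/-! ### Generic character families by Baire category -/

section Generic

/-- A neighbourhood in a product of copies of a metric space contains the points that are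
uniformly close in finitely many coordinates. -/
theorem exists_finset_forall_dist_lt_mem {J E : Type*} [PseudoMetricSpace E] {f : J → E}
    {U : Set (J → E)} (hU : U ∈ 𝓝 f) :
    ∃ (I : Finset J) (ε : ℝ), 0 < ε ∧ ∀ g : J → E, (∀ i ∈ I, dist (g i) (f i) < ε) → g ∈ U := by
  obtain ⟨W, hWU, hW, hfW⟩ := mem_nhds_iff.1 hU
  obtain ⟨I, u, hu, hI⟩ := isOpen_pi_iff.1 hW f hfW
  have hball : ∀ i, ∃ ε > 0, i ∈ I → Metric.ball (f i) ε ⊆ u i := fun i => by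
    by_cases hi : i ∈ I
    · obtain ⟨ε, hε, h⟩ := Metric.isOpen_iff.1 (hu i hi).1 _ (hu i hi).2
      exact ⟨ε, hε, fun _ => h⟩
    · exact ⟨1, one_pos, fun h => absurd h hi⟩
  choose e he hball using hball
  obtain ⟨ε, hε, hle⟩ : ∃ ε > 0, ∀ i ∈ I, ε ≤ e i := by
    rcases I.eq_empty_or_nonempty with rfl | hne
    · exact ⟨1, one_pos, by simp⟩
    · exact ⟨I.inf' hne e, (Finset.lt_inf'_iff hne).2 fun i _ => he i,
        fun i hi => Finset.inf'_le _ hi⟩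
  exact ⟨I, ε, hε, fun g hg => hWU (hI fun i hi =>
    hball i hi ((hg i hi).trans_le (hle i hi)))⟩

variable {H : Type*} [AddCommGroup H]

variable (H) in
/-- Sequences of continuous families, parametrized by the Cantor space, of characters of `H`. -/
def characterFamilies : Set (H × ℕ → C(ℕ → Bool, UnitAddCircle)) :=
  {f | ∀ x y m, f (x + y, m) = f (x, m) + f (y, m)}

theorem isClosed_characterFamilies : IsClosed (characterFamilies H) := by
  simp only [characterFamilies, ofPred_forall]
  refine isClosed_iInter fun x => isClosed_iInter fun y => isClosed_iInter fun m =>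
    isClosed_eq (by fun_prop) (by fun_prop)

instance : CompleteSpace (characterFamilies H) :=
  isClosed_characterFamilies.completeSpace_coe

/-- The members of a character family. -/
def familyChar (f : characterFamilies H) (m : ℕ) (α : ℕ → Bool) :
    H →+ UnitAddCircle :=
  AddMonoidHom.mk' (fun x => f.1 (x, m) α) fun x y => by
    rw [f.2 x y m]; rfl

/-- The locally constant character family depending on the first `k` digits only. -/
def stepFamily {k : ℕ} (F : ℕ → (Fin k → Bool) → (H →+ UnitAddCircle)) : characterFamilies H :=
  ⟨fun p => ⟨fun α => F p.2 (initialDigits k α) p.1,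
    (continuous_of_discreteTopology (f := fun σ => F p.2 σ p.1)).comp
      (continuous_initialDigits k)⟩, fun x y m => by ext α; simp⟩

/-- Only finitely many coordinates matter, each uniformly approximated by its values at padded
prefixes. Density proofs may therefore choose a character for each index and prefix independently.
-/
theorem exists_stepFamily_mem {f : characterFamilies H} {U : Set (characterFamilies H)}
    (hU : U ∈ 𝓝 f) : ∃ (k₀ : ℕ) (I : Finset (H × ℕ)) (ε : ℝ), 0 < ε ∧ ∀ k ≥ k₀,
      ∀ F : ℕ → (Fin k → Bool) → (H →+ UnitAddCircle),
        (∀ p ∈ I, ∀ σ, ‖F p.2 σ p.1 - familyChar f p.2 (padDigits σ) p.1‖ < ε) → stepFamily F ∈ U := by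
  obtain ⟨V, hV, hVU⟩ := mem_nhds_induced _ _ _ |>.1 hU
  obtain ⟨I, ε, hε, hI⟩ := exists_finset_forall_dist_lt_mem hV
  choose k hk using fun p => eventually_dist_padDigits_lt (f.1 p) (half_pos hε)
  refine ⟨I.sup k, I, ε / 2, half_pos hε, fun l hl F hF => hVU (hI _ fun p hp => ?_)⟩
  rw [ContinuousMap.dist_lt_iff hε]
  intro α
  have h1 := hk p l ((Finset.le_sup hp).trans hl) α
  have h2 := hF p hp (initialDigits l α)
  rw [← dist_eq_norm] at h2
  have h3 := dist_triangle (F p.2 (initialDigits l α) p.1)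
    (familyChar f p.2 (padDigits (initialDigits l α)) p.1) (f.1 p α)
  change dist (F p.2 (initialDigits l α) p.1) (f.1 p α) < ε
  change dist (familyChar f p.2 (padDigits (initialDigits l α)) p.1) (f.1 p α) < ε / 2 at h1
  linarith

theorem exists_character_ne_zero {x : H} (hx : x ≠ 0) : ∃ χ : H →+ UnitAddCircle, χ x ≠ 0 := by
  rcases Nat.eq_zero_or_pos (addOrderOf x) with h0 | hpos
  · obtain ⟨χ, -, hχ⟩ := exists_eq_zero_and_eq (⊥ : AddSubgroup H) x
      ((1 / (2 : ℕ) : ℝ) : UnitAddCircle) fun k hk => by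
        have h : k • x = 0 := by simpa using hk
        rw [← addOrderOf_dvd_iff_zsmul_eq_zero, h0] at h
        simp [Int.zero_dvd.1 (by simpa using h)]
    refine ⟨χ, fun h => ?_⟩
    have := AddCircle.addOrderOf_period_div (p := (1 : ℝ)) (n := 2) two_pos
    rw [← hχ, h, addOrderOf_zero] at this
    norm_num at this
  · obtain ⟨χ, -, hχ⟩ := exists_eq_zero_and_eq (⊥ : AddSubgroup H) x
      ((1 / (addOrderOf x : ℕ) : ℝ) : UnitAddCircle) fun k hk => by
        have h : k • x = 0 := by simpa using hk
        rw [← addOrderOf_dvd_iff_zsmul_eq_zero] at h ⊢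
        rwa [AddCircle.addOrderOf_period_div hpos]
    refine ⟨χ, fun h => hx ?_⟩
    have := AddCircle.addOrderOf_period_div (p := (1 : ℝ)) hpos
    rw [← hχ, h, addOrderOf_zero] at this
    exact AddMonoid.addOrderOf_eq_one_iff.1 this.symm

theorem isOpen_dense_char_ne_zero (α : ℕ → Bool) {x : H} (hx : x ≠ 0) :
    IsOpen {f : characterFamilies H | ∃ m, familyChar f m α x ≠ 0} ∧
      Dense {f : characterFamilies H | ∃ m, familyChar f m α x ≠ 0} := by
  constructor
  · rw [ofPred_exists]
    refine isOpen_iUnion fun m => ?_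
    have hc : Continuous fun f : characterFamilies H => f.1 (x, m) α :=
      (continuous_eval_const (F := C(ℕ → Bool, UnitAddCircle)) α).comp
        ((continuous_apply _).comp continuous_subtype_val)
    exact isOpen_ne.preimage hc
  · intro f
    rw [mem_closure_iff_nhds]
    intro U hU
    obtain ⟨k, I, ε, hε, h⟩ := exists_stepFamily_mem hU
    obtain ⟨χ, hχ⟩ := exists_character_ne_zero hx
    -- An index beyond all those constrained by the neighbourhood, where the character is free.
    let M := I.sup (fun p => p.2) + 1
    refine ⟨_, h k le_rfl (fun m σ => if m = M then χ else familyChar f m (padDigits σ)) ?_, M, ?_⟩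
    · intro p hp σ
      have : p.2 ≠ M := (Nat.lt_succ_of_le (Finset.le_sup (f := fun p => p.2) hp)).ne
      simpa [this] using hε
    · simpa [stepFamily, familyChar] using hχ

theorem isOpen_dense_approx {S : Set H} {n : ℕ} (hS : Thick S n) {l : ℕ}
    (t : Fin l → (Fin l → Bool) → UnitAddCircle) (ht : ∀ m σ, n • t m σ = 0) {ε : ℝ} (hε : 0 < ε) :
    IsOpen {f : characterFamilies H | ∃ s ∈ S, ∀ m : Fin l, ∀ α,
        ‖familyChar f m α s - t m (initialDigits l α)‖ < ε} ∧
      Dense {f : characterFamilies H | ∃ s ∈ S, ∀ m : Fin l, ∀ α,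
        ‖familyChar f m α s - t m (initialDigits l α)‖ < ε} := by
  constructor
  · let c : Fin l → C(ℕ → Bool, UnitAddCircle) := fun m =>
      ⟨fun α => t m (initialDigits l α), (continuous_of_discreteTopology (f := t m)).comp
        (continuous_initialDigits l)⟩
    have heq : {f : characterFamilies H | ∃ s ∈ S, ∀ m : Fin l, ∀ α,
        ‖familyChar f m α s - t m (initialDigits l α)‖ < ε} =
        ⋃ s ∈ S, ⋂ m : Fin l, {f | dist (f.1 (s, (m : ℕ))) (c m) < ε} := by
      ext f
      simp only [mem_iUnion, mem_iInter, mem_ofPred_eq, ContinuousMap.dist_lt_iff hε, exists_prop]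
      simp only [dist_eq_norm]
      rfl
    rw [heq]
    refine isOpen_biUnion fun s _ => isOpen_iInter_of_finite fun m => isOpen_lt ?_ continuous_const
    exact ((continuous_apply _).comp continuous_subtype_val).dist continuous_const
  · intro f
    rw [mem_closure_iff_nhds]
    intro U hU
    obtain ⟨k₀, I, δ, hδ, h⟩ := exists_stepFamily_mem hU
    let k := max k₀ l
    have hlk : l ≤ k := le_max_right _ _
    -- `s` is chosen before the targets, so a single `s` serves all indices and prefixes; a
    -- correction small on `I` is then added to each sampled character.
    obtain ⟨s, hs, hχ⟩ := hS.exists_forall_character (F := (fun p : H × ℕ => p.1) '' I)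
      (I.finite_toSet.image _) (lt_min hδ hε)
    have hchar : ∀ (m : ℕ) (σ : Fin k → Bool), ∃ χ : H →+ UnitAddCircle,
        (∀ p ∈ I, ‖χ p.1‖ < δ) ∧ ∀ hm : m < l,
          ‖familyChar f m (padDigits σ) s + χ s - t ⟨m, hm⟩ (initialDigits l (padDigits σ))‖ < ε := by
      intro m σ
      by_cases hm : m < l
      · obtain ⟨χ, h1, h2⟩ := hχ
          (t ⟨m, hm⟩ (initialDigits l (padDigits σ)) - familyChar f m (padDigits σ) s) (by
            rw [nsmul_sub, ht, ← map_nsmul, hS.1 s hs, map_zero, sub_zero])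
        refine ⟨χ, fun p hp => (h1 _ ⟨p, hp, rfl⟩).trans_le (min_le_left _ _), fun _ => ?_⟩
        refine lt_of_eq_of_lt ?_ (h2.trans_le (min_le_right _ _))
        congr 1
        abel
      · exact ⟨0, fun p _ => by simpa, fun h => absurd h hm⟩
    choose χ hχI hχs using hchar
    refine ⟨_, h k (le_max_left _ _) (fun m σ => familyChar f m (padDigits σ) + χ m σ) ?_, s, hs, ?_⟩
    · intro p hp σ
      simpa using hχI p.2 σ p hp
    · intro m α
      have := hχs m (initialDigits k α) m.2
      rwa [initialDigits_eq_of_le hlk (initialDigits_padDigits (initialDigits k α))] at this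

/-- A countable abelian group carries continuum many characters under which each of countably many
thick sets has dense image. -/
theorem exists_generic_characters [Countable H] {ι : Type*} [Countable ι] (S : ι → Set H)
    (n : ι → ℕ) (hS : ∀ i, Thick (S i) (n i)) (α₀ : ℕ → Bool) :
    ∃ h : ℕ × (ℕ → Bool) → (H →+ UnitAddCircle),
      (∀ x, (∀ m, h (m, α₀) x = 0) → x = 0) ∧
      ∀ i (J : Finset (ℕ × (ℕ → Bool))) (t : ℕ × (ℕ → Bool) → UnitAddCircle),
        (∀ j, n i • t j = 0) → ∀ ε > 0, ∃ s ∈ S i, ∀ j ∈ J, ‖h j s - t j‖ < ε := by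
  have hne : ∀ n : ℕ, Nonempty {t : UnitAddCircle // n • t = 0} := fun n => ⟨⟨0, by simp⟩⟩
  let u : (n : ℕ) → ℕ → {t : UnitAddCircle // n • t = 0} := fun n =>
    TopologicalSpace.denseSeq _
  -- Targets come from a dense sequence and depend only on finite prefixes, so countably many
  -- conditions handle all finite sets of parameters.
  let O : {x : H // x ≠ 0} ⊕ (ι × (Σ l : ℕ, (Fin l → (Fin l → Bool) → ℕ)) × ℕ) →
      Set (characterFamilies H) := Sum.elim (fun x => {f | ∃ m, familyChar f m α₀ x.1 ≠ 0})
    fun p => {f | ∃ s ∈ S p.1, ∀ m : Fin p.2.1.1, ∀ α,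
      ‖familyChar f m α s - (u (n p.1) (p.2.1.2 m (initialDigits p.2.1.1 α)) : UnitAddCircle)‖ <
        1 / ((p.2.2 : ℝ) + 1)}
  have hO : ∀ p, IsOpen (O p) ∧ Dense (O p) := by
    rintro (x | ⟨i, ⟨l, t⟩, q⟩)
    · exact isOpen_dense_char_ne_zero α₀ x.2
    · exact isOpen_dense_approx (hS i) (fun m σ => (u (n i) (t m σ) : UnitAddCircle))
        (fun m σ => (u (n i) (t m σ)).2) (by positivity)
  have : Nonempty (characterFamilies H) := ⟨⟨0, fun x y m => by simp⟩⟩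
  obtain ⟨f, hf⟩ := (dense_iInter_of_isOpen (fun p => (hO p).1) fun p => (hO p).2).nonempty
  rw [mem_iInter] at hf
  refine ⟨fun p => familyChar f p.1 p.2, fun x hx => ?_, fun i J t ht ε hε => ?_⟩
  · by_contra hne
    obtain ⟨m, hm⟩ := hf (Sum.inl ⟨x, hne⟩)
    exact hm (hx m)
  · obtain ⟨q, hq⟩ := exists_nat_one_div_lt (half_pos hε)
    have happ : ∀ j, ∃ a, ‖(u (n i) a : UnitAddCircle) - t j‖ < ε / 2 := fun j => by
      obtain ⟨a, ha⟩ := (TopologicalSpace.denseRange_denseSeq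
        {t : UnitAddCircle // n i • t = 0}).exists_dist_lt ⟨t j, ht j⟩ (half_pos hε)
      refine ⟨a, ?_⟩
      rw [dist_comm, Subtype.dist_eq, dist_eq_norm] at ha
      exact ha
    choose a ha using happ
    -- Prefixes of length `l` tell the parameters in `J` apart, so their targets can be prescribed
    -- independently.
    obtain ⟨l, hlm, hl⟩ : ∃ l, (∀ j ∈ J, j.1 < l) ∧ ∀ j ∈ J, ∀ j' ∈ J,
        initialDigits l j.2 = initialDigits l j'.2 → j.2 = j'.2 := by
      have hsep : ∀ α β : ℕ → Bool, ∃ l, initialDigits l α = initialDigits l β → α = β :=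
        fun α β => by
          by_cases h : α = β
          · exact ⟨0, fun _ => h⟩
          · obtain ⟨i, hi⟩ := Function.ne_iff.1 h
            exact ⟨i + 1, fun he => absurd (congrFun he ⟨i, i.lt_succ_self⟩) hi⟩
      choose L hL using hsep
      refine ⟨max (J.sup (fun j => j.1) + 1) ((J ×ˢ J).sup fun p => L p.1.2 p.2.2),
        fun j hj => lt_max_of_lt_left (Nat.lt_succ_of_le (Finset.le_sup (f := fun j => j.1) hj)),
        fun j hj j' hj' he => hL _ _ (initialDigits_eq_of_le (le_max_of_le_right ?_) he)⟩
      exact Finset.le_sup (f := fun p : (ℕ × (ℕ → Bool)) × (ℕ × (ℕ → Bool)) => L p.1.2 p.2.2)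
        (Finset.mk_mem_product hj hj')
    have hτ : ∀ (m : ℕ) (σ : Fin l → Bool), ∃ b, ∀ j ∈ J, j.1 = m → initialDigits l j.2 = σ →
        b = a j := fun m σ => by
      by_cases h : ∃ j ∈ J, j.1 = m ∧ initialDigits l j.2 = σ
      · obtain ⟨j, hj, rfl, rfl⟩ := h
        exact ⟨a j, fun j' hj' h1 h2 => by rw [Prod.ext h1.symm (hl j hj j' hj' h2.symm)]⟩
      · exact ⟨0, fun j hj h1 h2 => absurd ⟨j, hj, h1, h2⟩ h⟩
    choose τ hτ using hτ
    obtain ⟨s, hs, hsf⟩ := hf (Sum.inr (i, ⟨l, fun m σ => τ m σ⟩, q))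
    refine ⟨s, hs, fun j hj => ?_⟩
    have h1 := hsf ⟨j.1, hlm j hj⟩ j.2
    simp only [hτ j.1 _ j hj rfl rfl] at h1
    have h2 := norm_add_le (familyChar f j.1 j.2 s - u (n i) (a j)) (u (n i) (a j) - t j)
    rw [sub_add_sub_cancel] at h2
    linarith [ha j]

end Generic

/-! ### Separating points by few characters -/

section Independent

variable {N : Type*} [AddCommGroup N]

/-- A set is independent if the sum of the cyclic subgroups generated by its elements is direct. -/
def IndependentSet (S : Set N) : Prop :=
  ∀ c : N →₀ ℤ, (c.support : Set N) ⊆ S → Finsupp.linearCombination ℤ id c = 0 → ∀ s, c s • s = 0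

variable (N) in
/-- The cyclic subgroups generated by a suitable independent set span an essential subgroup. -/
theorem exists_independentSet_essential : ∃ S : Set N, IndependentSet S ∧ ∀ x : N, x ≠ 0 →
    ∃ (k : ℤ) (c : N →₀ ℤ), (c.support : Set N) ⊆ S ∧
      Finsupp.linearCombination ℤ id c = k • x ∧ k • x ≠ 0 := by
  obtain ⟨S, -, hS⟩ := zorn_subset_nonempty {S : Set N | IndependentSet S}
    (fun C hC hchain hne => ⟨⋃₀ C, fun c hc h0 => by
      rw [sUnion_eq_biUnion] at hc
      obtain ⟨A, hA, hcA⟩ :=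
        hchain.directedOn.exists_mem_subset_of_finset_subset_biUnion hne hc
      exact hC hA c hcA h0, fun s => subset_sUnion_of_mem⟩) ∅
    (fun c hc _ s => by
      have : c = 0 := by simpa using hc
      simp [this])
  refine ⟨S, hS.prop, fun x hx => ?_⟩
  by_contra! hcon
  -- If no nonzero multiple of `x` lies in the span of `S`, then `x` can be adjoined, against
  -- maximality.
  have hins : IndependentSet (insert x S) := fun c hc h0 => by
    have hsupp : ((c.erase x).support : Set N) ⊆ S := fun y hy => by
      classical
      rw [Finsupp.support_erase, Finset.mem_coe, Finset.mem_erase] at hy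
      exact (hc hy.2).resolve_left hy.1
    have hsplit : c x • x + Finsupp.linearCombination ℤ id (c.erase x) = 0 := by
      rw [← h0]
      conv_rhs => rw [← Finsupp.single_add_erase x c]
      simp
    have hcx : c x • x = 0 := hcon (c x) (-(c.erase x)) (by simpa using hsupp) (by
      rw [map_neg]
      exact (eq_neg_of_add_eq_zero_left hsplit).symm)
    rw [hcx, zero_add] at hsplit
    intro s
    by_cases hs : s = x
    · rw [hs, hcx]
    · have := hS.prop _ hsupp hsplit s
      rwa [Finsupp.erase_ne hs] at this
  have hxS : x ∈ S := hS.le_of_ge hins (subset_insert x S) (mem_insert x S)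
  have := hcon 1 (Finsupp.single x 1)
    ((Finset.coe_subset.2 Finsupp.support_single_subset).trans (by simpa using hxS)) (by simp)
  exact hx (by simpa using this)

theorem IndependentSet.exists_hom {S : Set N} (hS : IndependentSet S) {Q : Type*} [AddCommGroup Q]
    [DivisibleBy Q ℤ] (v : N → Q) (hv : ∀ (s : N) (k : ℤ), k • s = 0 → k • v s = 0) :
    ∃ χ : N →+ Q, ∀ c : N →₀ ℤ, (c.support : Set N) ⊆ S →
      χ (Finsupp.linearCombination ℤ id c) = Finsupp.linearCombination ℤ v c := by
  let M := Finsupp.supported ℤ ℤ S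
  obtain ⟨χ, hχ⟩ := exists_comp_eq
    ((Finsupp.linearCombination ℤ (id : N → N)).comp M.subtype).toAddMonoidHom
    ((Finsupp.linearCombination ℤ v).comp M.subtype).toAddMonoidHom fun m hm => by
      have h := hS m.1 m.2 hm
      change Finsupp.linearCombination ℤ v m.1 = 0
      rw [Finsupp.linearCombination_apply]
      exact Finset.sum_eq_zero fun s _ => hv s _ (h s)
  exact ⟨χ, fun c hc => hχ ⟨c, hc⟩⟩

/-- The circle has elements of every order: `1 / n` for finite order, the class of `√2` for infinite
order. -/
theorem exists_zsmul_eq_zero_iff (s : N) :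
    ∃ u : UnitAddCircle, ∀ k : ℤ, k • s = 0 ↔ k • u = 0 := by
  suffices h : ∃ u : UnitAddCircle, addOrderOf u = addOrderOf s by
    obtain ⟨u, hu⟩ := h
    exact ⟨u, fun k => by
      rw [← addOrderOf_dvd_iff_zsmul_eq_zero, ← addOrderOf_dvd_iff_zsmul_eq_zero, hu]⟩
  rcases Nat.eq_zero_or_pos (addOrderOf s) with h0 | hpos
  · refine ⟨((√2 : ℝ) : UnitAddCircle), ?_⟩
    rw [h0, addOrderOf_eq_zero_iff']
    intro n hn h
    rw [← AddCircle.coe_nsmul, AddCircle.coe_eq_zero_iff] at h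
    obtain ⟨k, hk⟩ := h
    refine (irrational_sqrt_two.natCast_mul hn.ne').ne_int k ?_
    simpa using hk.symm
  · exact ⟨_, AddCircle.addOrderOf_period_div (p := (1 : ℝ)) hpos⟩

/-- The characters of an abelian group embedding in the power set of `J` are separated by a
subfamily indexed by `J`. -/
theorem exists_separating_characters {J : Type*} [Infinite J] (e : N → Set J)
    (he : Function.Injective e) :
    ∃ ψ : J → (N →+ UnitAddCircle), ∀ x, (∀ j, ψ j x = 0) → x = 0 := by
  classical
  obtain ⟨E⟩ : Nonempty (J ≃ Finset J × Finset J) := by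
    rw [← Cardinal.eq, mk_prod, lift_id, mk_finset_of_infinite,
      mul_eq_self (aleph0_le_mk J)]
  obtain ⟨S, hS, hess⟩ := exists_independentSet_essential N
  choose u hu using fun s : N => exists_zsmul_eq_zero_iff s
  -- The pair `(F, A)` selects the generators `s` whose code `e s` has trace `A` on `F`. A suitable
  -- pair isolates one generator within any finite support.
  let v : Finset J × Finset J → N → UnitAddCircle := fun p s =>
    if e s ∩ p.1 = p.2 then u s else 0
  have hv : ∀ p (s : N) (k : ℤ), k • s = 0 → k • v p s = 0 := fun p s k hk => by
    by_cases h : e s ∩ p.1 = p.2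
    · simpa only [v, if_pos h] using (hu s k).1 hk
    · simp only [v, if_neg h, smul_zero]
  choose χ hχ using fun p => hS.exists_hom (v p) (hv p)
  refine ⟨fun j => χ (E j), fun x hx => ?_⟩
  by_contra hne
  obtain ⟨k, c, hcS, hck, hkx⟩ := hess x hne
  obtain ⟨s₀, hs₀⟩ : ∃ s, c s • s ≠ 0 := by
    by_contra! h
    refine hkx (hck.symm.trans ?_)
    rw [Finsupp.linearCombination_apply]
    exact Finset.sum_eq_zero fun s _ => h s
  have hsep : ∀ s, ∃ j, s ≠ s₀ → ¬ (j ∈ e s ↔ j ∈ e s₀) := fun s => by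
    by_cases h : s = s₀
    · exact ⟨Classical.arbitrary J, fun h' => absurd h h'⟩
    · by_contra! hcon
      exact h (he (Set.ext fun j => (hcon j).2))
  choose j hj using hsep
  -- `F` distinguishes `s₀` from the rest of the support, so evaluating at `k • x` leaves only the
  -- term `c s₀ • u s₀`.
  let F := c.support.image j
  let A := F.filter (· ∈ e s₀)
  have hA : ∀ s ∈ c.support, e s ∩ F = A ↔ s = s₀ := fun s hs => by
    constructor
    · intro h
      by_contra hss
      refine hj s hss ?_
      have hjF : j s ∈ F := Finset.mem_image_of_mem j hs
      have := Set.ext_iff.1 h (j s)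
      simpa [A, hjF] using this
    · rintro rfl
      ext i
      simp [A, and_comm]
  have h1 : χ (F, A) x = 0 := by
    obtain ⟨i, hi⟩ := E.surjective (F, A)
    rw [← hi]
    exact hx i
  have h2 := hχ (F, A) c hcS
  rw [hck, map_zsmul, h1, smul_zero, Finsupp.linearCombination_apply, Finsupp.sum,
    Finset.sum_eq_single s₀] at h2
  · by_cases hmem : s₀ ∈ c.support
    · simp only [v, if_pos ((hA s₀ hmem).2 rfl)] at h2
      exact hs₀ ((hu _ _).2 h2.symm)
    · exact hs₀ (by rw [Finsupp.notMem_support_iff.1 hmem, zero_smul])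
  · intro s hs hne'
    simp only [v, if_neg (fun h => hne' ((hA s hs).1 h)), smul_zero]
  · intro hmem
    rw [Finsupp.notMem_support_iff.1 hmem, zero_smul]

end Independent

/-! ### From the countable subgroup to `G` -/

section Assembly

variable {G : Type*} [AddCommGroup G]

theorem exists_countable_addSubgroup {U : Set G} (hU : U.Countable) :
    ∃ H : AddSubgroup G, Countable H ∧ U ⊆ H := by
  have := hU.to_subtype
  refine ⟨(Finsupp.linearCombination ℤ ((↑) : U → G)).toAddMonoidHom.range,
    (countable_range _).to_subtype, fun u hu => ⟨Finsupp.single ⟨u, hu⟩ 1, by simp⟩⟩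

theorem exists_injective_of_mk_le {G : Type*} (hG : #G ≤ 2 ^ 𝔠) {J : Type} (hJ : 𝔠 ≤ #J) :
    ∃ e : G → Set J, Function.Injective e := by
  have h : Cardinal.lift.{0} #G ≤ Cardinal.lift #(Set J) := by
    rw [lift_uzero, mk_set, lift_two_power]
    refine hG.trans (power_le_power_left two_ne_zero ?_)
    exact lift_continuum.symm.le.trans (lift_le.2 hJ)
  obtain ⟨e⟩ := lift_mk_le'.1 h
  exact ⟨e, e.injective⟩

/-- An abelian group of size at most `2 ^ 𝔠` has a separating family of characters under which each
of countably many thick sets has dense image. -/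
theorem exists_separating_generic_characters (hG : #G ≤ 2 ^ 𝔠) {ι : Type*} [Countable ι]
    (S : ι → Set G) (n : ι → ℕ) (hS : ∀ i, Thick (S i) (n i)) :
    ∃ h : ℕ × (ℕ → Bool) → (G →+ UnitAddCircle),
      (∀ x, (∀ j, h j x = 0) → x = 0) ∧
      ∀ i (J : Finset (ℕ × (ℕ → Bool))) (t : ℕ × (ℕ → Bool) → UnitAddCircle),
        (∀ j, n i • t j = 0) → ∀ ε > 0, ∃ s ∈ S i, ∀ j ∈ J, ‖h j s - t j‖ < ε := by
  choose S' hS'S hS'c hS' using fun i => (hS i).exists_countable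
  obtain ⟨H, _, hSH⟩ := exists_countable_addSubgroup (countable_iUnion hS'c)
  let α₀ : ℕ → Bool := fun _ => false
  obtain ⟨f, hf₀, hf⟩ := exists_generic_characters (fun i => ((↑) : H → G) ⁻¹' S' i) n
    (fun i => (hS' i).preimage ((subset_iUnion S' i).trans hSH)) α₀
  choose g hg using fun j => exists_extend H (f j)
  let N : AddSubgroup G := ⨅ m, (g (m, α₀)).ker
  have hN : ∀ x ∈ N, ∀ m, g (m, α₀) x = 0 := fun x hx m => (AddSubgroup.mem_iInf.1 hx) m
  let J := {j : ℕ × (ℕ → Bool) // j.2 ≠ α₀}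
  have hJ : 𝔠 ≤ #J := by
    have h1 : #(ℕ → Bool) = 𝔠 := by simp
    rw [← h1]
    -- The leading digit `true` keeps the sequence away from the constant `α₀`.
    refine mk_le_of_injective (f := fun α => (⟨(0, fun i => Nat.casesOn i true α), fun h => ?_⟩ : J))
      fun α β h => ?_
    · simpa [α₀] using congrFun h 0
    · funext i
      exact congrFun (congrArg (fun j : J => j.1.2) h) (i + 1)
  have : Infinite J := infinite_iff.2 (aleph0_le_continuum.trans hJ)
  obtain ⟨e, he⟩ := exists_injective_of_mk_le hG hJ
  obtain ⟨ψ, hψ⟩ := exists_separating_characters (fun x : N => e x)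
    (he.comp Subtype.val_injective)
  have hh : ∀ j, ∃ χ : G →+ UnitAddCircle, (∀ x : H, χ x = f j x) ∧ (j.2 = α₀ → χ = g j) ∧
      ∀ hj : j.2 ≠ α₀, ∀ x : N, χ x = ψ ⟨j, hj⟩ x := fun j => by
    by_cases hj : j.2 = α₀
    · exact ⟨g j, hg j, fun _ => rfl, fun h => absurd hj h⟩
    -- As `N` and `H` meet trivially, `ψ` on `N` and `f j` on `H` have a common extension.
    · obtain ⟨χ, hχ⟩ := exists_comp_eq (N.subtype.coprod H.subtype) ((ψ ⟨j, hj⟩).coprod (f j))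
        (by
          rintro ⟨x, y⟩ hxy
          have hxy : (x : G) + y = 0 := hxy
          have hy : y = 0 := hf₀ y fun m => by
            rw [← hg, ← neg_eq_of_add_eq_zero_right hxy, map_neg, hN x x.2, neg_zero]
          have hx : x = 0 := by
            rw [hy] at hxy
            exact Subtype.ext (by simpa using hxy)
          simp [hx, hy])
      exact ⟨χ, fun x => by simpa using hχ (0, x), fun h => absurd h hj,
        fun _ x => by simpa using hχ (x, 0)⟩
  choose h hhH hhg hhψ using hh
  refine ⟨h, fun x hx => ?_, fun i F t ht ε hε => ?_⟩
  · have hxN : x ∈ N := AddSubgroup.mem_iInf.2 fun m => by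
      rw [AddMonoidHom.mem_ker, ← hhg (m, α₀) rfl]
      exact hx _
    have := hψ ⟨x, hxN⟩ fun j => by rw [← hhψ j.1 j.2]; exact hx _
    exact congrArg Subtype.val this
  · obtain ⟨s, hs, hst⟩ := hf i F t ht ε hε
    exact ⟨s, hS'S i hs, fun j hj => by rw [hhH]; exact hst j hj⟩

theorem isClosed_of_isAlgebraicSubset [TopologicalSpace G] [IsTopologicalAddGroup G] [T2Space G]
    {S : Set G} (hS : IsAlgebraicSubset S) : IsClosed S := by
  obtain ⟨𝒜, h𝒜, rfl⟩ := hS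
  refine isClosed_sInter fun A hA => ?_
  obtain ⟨F, hF, hF', rfl⟩ := h𝒜 A hA
  rw [sUnion_eq_biUnion]
  refine hF.isClosed_biUnion fun B hB => ?_
  obtain ⟨g, n, rfl⟩ := hF' B hB
  exact (Homeomorph.addLeft g).isClosedMap _
    (isClosed_eq (continuous_const_smul n) continuous_const)

/-- The uniformity of `G` is pulled back from a compact group, hence totally bounded, and so is that
of the completion. -/
theorem isPrecompact_of_isInducing {G : Type*} [AddCommGroup G] [TopologicalSpace G]
    [IsTopologicalAddGroup G] {K : Type*} [AddCommGroup K] [UniformSpace K] [IsUniformAddGroup K]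
    [CompactSpace K] (π : G →+ K) (hπ : IsInducing π) : IsPrecompact G := by
  unfold IsPrecompact
  let : UniformSpace G := IsTopologicalAddGroup.rightUniformSpace G
  have hu : IsUniformInducing π := by
    refine ⟨?_⟩
    rw [uniformity_eq_comap_nhds_zero K, Filter.comap_comap,
      show uniformity G = Filter.comap (fun p : G × G => p.2 + -p.1) (𝓝 0) from rfl, hπ.nhds_eq_comap,
      Filter.comap_comap, map_zero]
    congr 1
    ext p
    simp [sub_eq_add_neg]
  have htb : TotallyBounded (univ : Set G) := by
    simpa using totallyBounded_preimage hu (isCompact_univ (X := K)).totallyBounded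
  have hc := (htb.image (UniformSpace.Completion.uniformContinuous_coe G)).closure
  rw [image_univ, UniformSpace.Completion.denseRange_coe.closure_range] at hc
  exact ⟨hc.isCompact_of_isClosed isClosed_univ⟩

end Assembly

end AbelianZariski

/-! ### The main theorem -/

open AbelianZariski in
theorem mainTheorem5 {G : Type*} [AddCommGroup G] (hG : #G ≤ 2 ^ 𝔠)
    (𝒳 : Set (Set G)) (h𝒳 : 𝒳.Countable) :
    ∃ (𝒯 : TopologicalSpace G) (_ : IsTopologicalAddGroup G),
      T2Space G ∧ AbelianZariski.IsPrecompact G ∧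
        ∀ X ∈ 𝒳, closure[𝒯] X = closure[AbelianZariski.zariskiTopology G] X := by
  choose P hPfin hPcov hPthick using fun X : Set G => exists_finite_thick_cover X
  have := h𝒳.to_subtype
  have := fun X => (hPfin X).to_subtype
  obtain ⟨h, hsep, hdense⟩ := exists_separating_generic_characters hG
    (ι := Σ X : 𝒳, P X) (fun i => {s | i.2.1.1 + s ∈ i.1.1 ∧ i.2.1.2 • s = 0})
    (fun i => i.2.1.2) fun i => hPthick _ _ i.2.2
  let π : G →+ (ℕ × (ℕ → Bool) → UnitAddCircle) := AddMonoidHom.pi h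
  have hπinj : Function.Injective π :=
    (injective_iff_map_eq_zero π).2 fun x hx => hsep x fun j => congrFun hx j
  let 𝒯 : TopologicalSpace G := TopologicalSpace.induced π inferInstance
  have hπ : IsInducing π := ⟨rfl⟩
  have htop : IsTopologicalAddGroup G := topologicalAddGroup_induced π
  have hT2 : T2Space G := T2Space.of_injective_continuous hπinj hπ.continuous
  refine ⟨𝒯, htop, hT2, isPrecompact_of_isInducing π hπ, fun X hX => ?_⟩
  apply Subset.antisymm
  · refine closure_minimal (@subset_closure _ (zariskiTopology G) _) ?_
    exact isClosed_of_isAlgebraicSubset (isClosed_zariskiTopology_iff.1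
      (@isClosed_closure _ (zariskiTopology G) _))
  -- The covering cosets form a Zariski closed set containing `X`, so it suffices that each of their
  -- points lie in the closure of `X` for `𝒯`.
  · have hcov : X ⊆ ⋃₀ ((fun p : G × ℕ => (fun x => p.1 + x) '' {x | p.2 • x = 0}) '' P X) :=
      fun x hx => by
        obtain ⟨p, hp, hpx⟩ := hPcov X x hx
        exact ⟨_, ⟨p, hp, rfl⟩, x - p.1, hpx, by simp⟩
    have hclosed : IsClosed[zariskiTopology G]
        (⋃₀ ((fun p : G × ℕ => (fun x => p.1 + x) '' {x | p.2 • x = 0}) '' P X)) := by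
      refine isClosed_zariskiTopology_iff.2 ⟨{_}, ?_, (sInter_singleton _).symm⟩
      rintro _ rfl
      refine ⟨_, (hPfin X).image _, ?_, rfl⟩
      rintro _ ⟨p, -, rfl⟩
      exact ⟨p.1, p.2, rfl⟩
    refine (@closure_minimal _ (zariskiTopology G) _ _ hcov hclosed).trans ?_
    rintro _ ⟨_, ⟨p, hp, rfl⟩, y, hy, rfl⟩
    rw [hπ.closure_eq_preimage_closure_image, mem_preimage, mem_closure_iff]
    intro U hU hyU
    obtain ⟨F, ε, hε, hF⟩ := exists_finset_forall_dist_lt_mem (hU.mem_nhds hyU)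
    -- The targets `h j y` are admissible because `y` is killed by `p.2`; translating by `p.1` then
    -- gives a point of `X`.
    obtain ⟨s, hs, hsF⟩ := hdense ⟨⟨X, hX⟩, ⟨p, hp⟩⟩ F (fun j => h j y)
      (fun j => by rw [← map_nsmul, show p.2 • y = 0 from hy, map_zero]) ε hε
    refine ⟨π (p.1 + s), hF _ fun j hj => ?_, mem_image_of_mem _ hs.1⟩
    rw [dist_eq_norm]
    change ‖h j (p.1 + s) - h j (p.1 + y)‖ < ε
    rw [map_add, map_add, add_sub_add_left_eq_sub]
    exact hsF j hj
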